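/- Let $d\ge 1$. A *Finsler norm* on $\mathbb{R}^d$ is a function $\varphi:\mathbb{R}^d\to[0,\infty)$ with $\varphi(\lambda q)=\lambda\varphi(q)$ for $\lambda>0$, $\varphi(q_1+q_2)\le\varphi(q_1)+\varphi(q_2)$, and $\min_{q\ne 0}\varphi(q)/\|q\|>0$, where $\|\cdot\|$ is the Euclidean norm (symmetry is not required). It is *polyhedral* if there is a nonempty finite set $\{p_1,\dots,p_N\}\subseteq\mathbb{R}^d\setminus\{0\}$ with $\varphi(q)=\max_{1\le i\le N}\langle p_i,q\rangle$ for all $q$. The dual norm is $\varphi^*(p)=\max_{q\ne0}\langle p,q\rangle/\varphi(q)$, and $$\partial\varphi^*(p)=\{v\in\mathbb{R}^d:\ \varphi^*(p')\ge\varphi^*(p)+\langle v,p'-p\rangle\ \text{for all } p'\in\mathbb{R}^d\}$$ is its subdifferential. For $p\in\mathbb{R}^d$ let $\mathcal{T}(p,\varphi)=\partial\varphi^*(p)^\perp$ be the set of vectors orthogonal to $\partial\varphi^*(p)$. For a linear subspace $V\subseteq\mathbb{R}^d$ with orthogonal projection $\pi_V$, let $\mathcal{S}_V$ be the space of symmetric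 $d\times d$ matrices $X$ with $\pi_VX\pi_V=X$, and put $\mathcal{S}(p,\varphi)=\mathcal{S}_{\langle p\rangle\oplus\mathcal{T}(p,\varphi)}$, where $\langle p\rangle$ is the linear span of $p$. A Finsler norm $\psi$ is a *shielding norm for* $\varphi$ if $\psi\in C^2(\mathbb{R}^d\setminus\{0\})$ and $D^2\psi(q)\in\mathcal{S}(D\psi(q),\varphi)$ for every $q\ne0$. **Theorem.** Let $\varphi$ be a polyhedral Finsler norm on $\mathbb{R}^d$. Then: 1. $\varphi$ has a shielding norm. 2. For every $\delta>0$ there is a shielding norm $\psi_\delta$ for $\varphi$ with $\sup\{|\psi_\delta(e)-\varphi(e)|:\|e\|=1\}\le\delta$. 3. For every $c>0$ there is a sequence of convex functions $f_{c,n}\in C^\infty(\mathbb{R}^d)$, $n\in\mathbb{N}$, such that $f_{c,n}\to\varphi$ uniformly on $\{\varphi\ge c\}$ as $n\to\infty$ and, for every $n$ and every $q$ with $\varphi(q)\ge c$, $$\varphi^*(Df_{c,n}(q))=1,\qquad D^2f_{c,n}(q)\in\mathcal{S}_{\mathcal{T}(Df_{c,n}(q),\varphi)},\qquad \partial\varphi^*(Df_{c,n}(q))\subseteq\operatorname{Ker}D^2f_{c,n}(q).$$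 4. There is a sequence $(\varphi_n)_{n\in\mathbb{N}}$ of shielding norms for $\varphi$ with $\varphi_n\to\varphi$ locally uniformly on $\mathbb{R}^d$. -/

import Mathlib

open Filter Topology Set
open scoped RealInnerProductSpace ContDiff

/-- The Euclidean space `ℝᵈ`. -/
abbrev E (d : ℕ) : Type := EuclideanSpace ℝ (Fin d)

/-- A Finsler norm on `ℝᵈ`: a nonnegative function that is positively one-homogeneous,
subadditive, and positive definite in the sense that `φ q / ‖q‖` is bounded below by a positive
constant on `ℝᵈ \ {0}`.  It need not be symmetric. -/
structure IsFinslerNorm {d : ℕ} (φ : E d → ℝ) : Prop where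
  nonneg : ∀ q, 0 ≤ φ q
  pos_homogeneous : ∀ (r : ℝ) (q : E d), 0 < r → φ (r • q) = r * φ q
  subadditive : ∀ q₁ q₂, φ (q₁ + q₂) ≤ φ q₁ + φ q₂
  pos_definite : ∃ m : ℝ, 0 < m ∧ ∀ q, q ≠ 0 → m ≤ φ q / ‖q‖

/-- A Finsler norm is polyhedral if it is the maximum of finitely many linear functions
`q ↦ ⟪p, q⟫` with `p ≠ 0`. -/
structure IsPolyhedralFinslerNorm {d : ℕ} (φ : E d → ℝ) : Prop extends IsFinslerNorm φ where
  exists_points : ∃ P : Finset (E d), (0 : E d) ∉ P ∧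
    ∀ q, IsGreatest {t : ℝ | ∃ p ∈ P, t = ⟪p, q⟫} (φ q)

/-- The dual norm `φ* p = max {⟪p, q⟫ / φ q : q ≠ 0}`. -/
noncomputable def dualNorm {d : ℕ} (φ : E d → ℝ) (p : E d) : ℝ :=
  sSup {t : ℝ | ∃ q : E d, q ≠ 0 ∧ t = ⟪p, q⟫ / φ q}

/-- The subdifferential `∂φ(q)`. -/
def subdiff {d : ℕ} (φ : E d → ℝ) (q : E d) : Set (E d) :=
  {p | ∀ q', φ q + ⟪p, q' - q⟫ ≤ φ q'}

/-- The generalized tangent space `𝒯(p, φ) = ∂φ*(p)^⊥`. -/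
noncomputable def tangentSpace {d : ℕ} (p : E d) (φ : E d → ℝ) : Submodule ℝ (E d) :=
  (Submodule.span ℝ (subdiff (dualNorm φ) p))ᗮ

/-- `𝒮_V`: the symmetric operators `X` on `ℝᵈ` with `π_V ∘ X ∘ π_V = X`, where `π_V` is the
orthogonal projection onto `V`. -/
def symOn {d : ℕ} (V : Submodule ℝ (E d)) : Set (E d →L[ℝ] E d) :=
  {X | (∀ u w, ⟪X u, w⟫ = ⟪u, X w⟫) ∧
    V.starProjection ∘L X ∘L V.starProjection = X}

/-- `𝒮(p, φ) = 𝒮_V` with `V = ⟨p⟩ ⊕ 𝒯(p, φ)`. -/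
def compatSym {d : ℕ} (p : E d) (φ : E d → ℝ) : Set (E d →L[ℝ] E d) :=
  symOn (Submodule.span ℝ {p} ⊔ tangentSpace p φ)

/-- The Hessian `D²u(q)`, as a linear operator on `ℝᵈ`. -/
noncomputable def hessian {d : ℕ} (u : E d → ℝ) (q : E d) : E d →L[ℝ] E d :=
  fderiv ℝ (gradient u) q

/-- `ψ` is a shielding norm for `φ`: a Finsler norm, `C²` away from the origin, with
`D²ψ(q) ∈ 𝒮(Dψ(q), φ)` for all `q ≠ 0`. -/
structure IsShieldingNorm {d : ℕ} (φ ψ : E d → ℝ) : Prop where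
  isFinslerNorm : IsFinslerNorm ψ
  contDiffOn : ContDiffOn ℝ 2 ψ {0}ᶜ
  hessian_mem : ∀ q, q ≠ 0 → hessian ψ q ∈ compatSym (gradient ψ q) φ

/-! Write `φ = maxCoord ∘ pairing p` and replace the maximum by a smooth monotone function `F` of
the coordinates `⟪p i, q⟫`. The gradient of `F ∘ pairing p` is `∑ l i • p i` with `l i ≥ 0`, and the
Hessian sends `w` to `∑ a i • p i`, where `a i` is a derivative of the nonnegative function `l i`
and so vanishes wherever `l i` does.

If the smoothing is fine enough, only almost active `p i` carry weight, and by compactness these lie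
on a common face (`exists_common_face`). Every subgradient of `φ*` at the gradient then pairs to 1
with each weighted `p i` (`inner_eq_one_of_mem_subdiff`), so `∑ a i • p i` is tangent as soon as `∑
a i = 0`. In general this holds after subtracting a multiple of the gradient, which gives the space
`⟨p⟩ ⊕ 𝒯`.

Two smoothings are used. Averaging over multiplicative perturbations (`mulMax`) keeps homogeneity
and yields shielding norms. Averaging over translations (`addMax`) keeps `∑ l i = 1`, hence `∑ a i =
0` and dual norm 1, but is fine relative to `φ` only where `φ ≥ c`. -/

/-! ### Derivatives of functions of the coordinates `⟪p i, q⟫`. -/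

section Pairing

variable {d : ℕ} {ι : Type*}

/-- The linear map `q ↦ (⟪p i, q⟫)ᵢ`. -/
noncomputable def pairing (p : ι → E d) : E d →L[ℝ] (ι → ℝ) :=
  ContinuousLinearMap.pi fun i => innerSL ℝ (p i)

@[simp]
theorem pairing_apply (p : ι → E d) (q : E d) (i : ι) : pairing p q i = ⟪p i, q⟫ := rfl

variable [Fintype ι] [DecidableEq ι]

/-- The `i`-th partial derivative. -/
noncomputable def partialDeriv (F : (ι → ℝ) → ℝ) (i : ι) (t : ι → ℝ) : ℝ :=
  fderiv ℝ F t (Pi.single i 1)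

theorem fderiv_eq_sum_partialDeriv (F : (ι → ℝ) → ℝ) (t x : ι → ℝ) :
    fderiv ℝ F t x = ∑ i, x i * partialDeriv F i t := by
  conv_lhs => rw [← Finset.univ_sum_single x]
  rw [map_sum]
  refine Finset.sum_congr rfl fun i _ => ?_
  have : (Pi.single i (x i) : ι → ℝ) = x i • Pi.single i 1 := by
    rw [← Pi.single_smul, smul_eq_mul, mul_one]
  rw [this, map_smul, smul_eq_mul, partialDeriv]

theorem partialDeriv_eq_zero_of_eventually {F : (ι → ℝ) → ℝ} {t : ι → ℝ} {i : ι}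
    (hF : DifferentiableAt ℝ F t)
    (h : ∀ᶠ a : ℝ in 𝓝 0, F (t + a • Pi.single i 1) = F t) : partialDeriv F i t = 0 := by
  have h1 : HasDerivAt (fun a : ℝ => F (t + a • Pi.single i 1)) (partialDeriv F i t) 0 :=
    hF.hasFDerivAt.hasLineDerivAt (Pi.single i 1)
  exact h1.unique ((hasDerivAt_const (0 : ℝ) (F t)).congr_of_eventuallyEq h)

theorem partialDeriv_nonneg {F : (ι → ℝ) → ℝ} (hF : Monotone F) (i : ι) (t : ι → ℝ) :
    0 ≤ partialDeriv F i t := by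
  by_cases hd : DifferentiableAt ℝ F t
  · have h : HasDerivAt (fun a : ℝ => F (t + a • Pi.single i 1)) (fderiv ℝ F t (Pi.single i 1)) 0 :=
      hd.hasFDerivAt.hasLineDerivAt (Pi.single i 1)
    rw [partialDeriv, ← h.deriv]
    refine Monotone.deriv_nonneg fun a b hab => hF ?_
    gcongr
    exact Pi.single_nonneg.2 zero_le_one
  · simp [partialDeriv, fderiv_zero_of_not_differentiableAt hd]

/-- A zero of a nonnegative function is a minimum. Thus the Hessian involves only those `p i` that
already occur in the gradient. -/
theorem fderiv_partialDeriv_eq_zero {F : (ι → ℝ) → ℝ} (hF : Monotone F) {i : ι} {t : ι → ℝ}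
    (h : partialDeriv F i t = 0) : fderiv ℝ (partialDeriv F i) t = 0 := by
  refine IsLocalMin.fderiv_eq_zero (Eventually.of_forall fun x => ?_)
  rw [h]
  exact partialDeriv_nonneg hF i x

theorem gradient_comp_pairing {F : (ι → ℝ) → ℝ} (p : ι → E d) {q : E d}
    (hF : DifferentiableAt ℝ F (pairing p q)) :
    gradient (fun x => F (pairing p x)) q = ∑ i, partialDeriv F i (pairing p q) • p i := by
  refine HasGradientAt.gradient ?_
  rw [hasGradientAt_iff_hasFDerivAt]
  refine HasFDerivAt.congr_fderiv (hF.hasFDerivAt.comp q (pairing p).hasFDerivAt) ?_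
  ext w
  simp [fderiv_eq_sum_partialDeriv, mul_comm]

theorem differentiableAt_partialDeriv {F : (ι → ℝ) → ℝ} {t : ι → ℝ}
    (hF : ContDiffAt ℝ 2 F t) (i : ι) : DifferentiableAt ℝ (partialDeriv F i) t := by
  have h : ContDiffAt ℝ 1 (fderiv ℝ F) t := hF.fderiv_right (by norm_num)
  exact (h.differentiableAt (by norm_num)).clm_apply (differentiableAt_const _)

theorem hessian_comp_pairing {F : (ι → ℝ) → ℝ} (p : ι → E d) {q : E d}
    (hF : ContDiffAt ℝ 2 F (pairing p q)) (w : E d) :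
    hessian (fun x => F (pairing p x)) q w =
      ∑ i, fderiv ℝ (partialDeriv F i) (pairing p q) (pairing p w) • p i := by
  have hev : ∀ᶠ x in 𝓝 q, gradient (fun x => F (pairing p x)) x =
      ∑ i, partialDeriv F i (pairing p x) • p i := by
    have h1 : ∀ᶠ t in 𝓝 (pairing p q), DifferentiableAt ℝ F t :=
      (hF.eventually (by simp)).mono fun t ht => ht.differentiableAt (by norm_num)
    exact ((pairing p).continuous.tendsto q |>.eventually h1).mono
      fun x hx => gradient_comp_pairing p hx
  rw [hessian, Filter.EventuallyEq.fderiv_eq hev]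
  have : HasFDerivAt (fun x => ∑ i, partialDeriv F i (pairing p x) • p i)
      (∑ i, ((fderiv ℝ (partialDeriv F i) (pairing p q)).comp (pairing p)).smulRight (p i)) q := by
    refine HasFDerivAt.fun_sum fun i _ => ?_
    exact ((differentiableAt_partialDeriv hF i).hasFDerivAt.comp q
      (pairing p).hasFDerivAt).smul_const (p i)
  rw [this.fderiv]
  simp

end Pairing

/-! ### Symmetry of the Hessian and membership in `𝒮_V`. -/

section Hessian

variable {d : ℕ}

theorem hessian_symm {u : E d → ℝ} {q : E d} (hu : ContDiffAt ℝ 2 u q) (v w : E d) :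
    ⟪hessian u q v, w⟫ = ⟪v, hessian u q w⟫ := by
  have hd : DifferentiableAt ℝ (fderiv ℝ u) q :=
    (hu.fderiv_right (m := 1) (by norm_num)).differentiableAt (by norm_num)
  have key : ∀ v w, ⟪hessian u q v, w⟫ = fderiv ℝ (fderiv ℝ u) q v w := by
    intro v w
    have h := ((InnerProductSpace.toDual ℝ (E d)).symm.toContinuousLinearEquiv
      |>.toContinuousLinearMap.hasFDerivAt).comp q hd.hasFDerivAt
    have h2 : hessian u q = _ := h.fderiv
    rw [h2]
    exact InnerProductSpace.toDual_symm_apply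
  rw [key, real_inner_comm, key]
  exact (hu.isSymmSndFDerivAt (by simp)) v w

/-- By symmetry, an operator with range in `V` also kills the orthogonal complement of `V`, so both
projections can be dropped. -/
theorem mem_symOn_of_range_le {V : Submodule ℝ (E d)} {X : E d →L[ℝ] E d}
    (hsymm : ∀ u w, ⟪X u, w⟫ = ⟪u, X w⟫) (hV : ∀ u, X u ∈ V) : X ∈ symOn V := by
  refine ⟨hsymm, ?_⟩
  have h1 : ∀ u, V.starProjection (X u) = X u := fun u =>
    Submodule.starProjection_eq_self_iff.2 (hV u)
  ext1 u
  simp only [ContinuousLinearMap.comp_apply, h1]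
  refine ext_inner_right ℝ fun w => ?_
  rw [hsymm, Submodule.inner_starProjection_left_eq_right, h1, hsymm]

end Hessian

/-! ### Faces of the polyhedral norm and tangent spaces of the dual norm. -/

section Faces

variable {d : ℕ} {φ : E d → ℝ} {ι : Type*} [Fintype ι]

theorem IsFinslerNorm.pos (hφ : IsFinslerNorm φ) {q : E d} (hq : q ≠ 0) : 0 < φ q := by
  obtain ⟨m, hm, h⟩ := hφ.pos_definite
  have hq' : 0 < ‖q‖ := norm_pos_iff.2 hq
  exact (mul_pos hm hq').trans_le ((le_div_iff₀ hq').1 (h q hq))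

/-- The dual norm of a nonnegative combination of points of a common face. -/
theorem dualNorm_sum_face (hφ : IsFinslerNorm φ) {p : ι → E d} (hp : ∀ i x, ⟪p i, x⟫ ≤ φ x)
    {y : E d} (hy : y ≠ 0) {l : ι → ℝ} (hl : ∀ i, 0 ≤ l i)
    (hface : ∀ i, l i ≠ 0 → ⟪p i, y⟫ = φ y) :
    dualNorm φ (∑ i, l i • p i) = ∑ i, l i := by
  refine IsGreatest.csSup_eq ⟨⟨y, hy, ?_⟩, ?_⟩
  · rw [eq_div_iff (hφ.pos hy).ne', sum_inner, Finset.sum_mul]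
    refine Finset.sum_congr rfl fun i _ => ?_
    rw [real_inner_smul_left]
    by_cases h : l i = 0
    · simp [h]
    · rw [hface i h]
  · rintro _ ⟨q, hq, rfl⟩
    rw [div_le_iff₀ (hφ.pos hq), sum_inner, Finset.sum_mul]
    refine Finset.sum_le_sum fun i _ => ?_
    rw [real_inner_smul_left]
    exact mul_le_mul_of_nonneg_left (hp i q) (hl i)

theorem dualNorm_le_one (hφ : IsFinslerNorm φ) {p y : E d} (hy : y ≠ 0)
    (hp : ∀ x, ⟪p, x⟫ ≤ φ x) : dualNorm φ p ≤ 1 := by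
  refine csSup_le ⟨_, y, hy, rfl⟩ ?_
  rintro _ ⟨q, hq, rfl⟩
  exact (div_le_one (hφ.pos hq)).2 (hp q)

/-- Testing the subgradient inequality at `2g` and `0` gives `⟪v, g⟫ = φ*(g) = ∑ l j`; testing it at
`p j` then gives `⟪v, p j⟫ ≤ φ*(p j) ≤ 1`. So `∑ l j * (1 - ⟪v, p j⟫)` is a vanishing sum of
nonnegative terms. -/
theorem inner_eq_one_of_mem_subdiff (hφ : IsFinslerNorm φ) {p : ι → E d}
    (hp : ∀ i x, ⟪p i, x⟫ ≤ φ x) {y : E d} (hy : y ≠ 0) {l : ι → ℝ} (hl : ∀ i, 0 ≤ l i)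
    (hface : ∀ i, l i ≠ 0 → ⟪p i, y⟫ = φ y) {v : E d}
    (hv : v ∈ subdiff (dualNorm φ) (∑ i, l i • p i)) {i : ι} (hi : l i ≠ 0) :
    ⟪v, p i⟫ = 1 := by
  set g := ∑ i, l i • p i with hg
  have h1 : dualNorm φ g = ∑ i, l i := dualNorm_sum_face hφ hp hy hl hface
  have h2 : dualNorm φ ((2 : ℝ) • g) = 2 * ∑ i, l i := by
    rw [hg, Finset.smul_sum, Finset.mul_sum]
    simp_rw [smul_smul]
    exact dualNorm_sum_face hφ hp hy (fun i => by have := hl i; positivity)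
      fun i h => hface i (by simpa using h)
  have h0 : dualNorm φ (0 : E d) = 0 := by
    simpa using dualNorm_sum_face (l := fun _ : ι => (0 : ℝ)) hφ hp hy (by simp) (by simp)
  have e2 := hv ((2 : ℝ) • g)
  have e0 := hv 0
  rw [h1, h2, two_smul, add_sub_cancel_right] at e2
  rw [h1, h0, zero_sub, inner_neg_right] at e0
  have hle : ∀ j, ⟪v, p j⟫ ≤ 1 := by
    intro j
    have e := hv (p j)
    rw [h1, inner_sub_right] at e
    linarith [dualNorm_le_one hφ hy (hp j)]
  have hsum : ∑ j, l j * (1 - ⟪v, p j⟫) = 0 := by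
    have : ⟪v, g⟫ = ∑ j, l j * ⟪v, p j⟫ := by
      simp [hg, inner_sum, real_inner_smul_right]
    simp_rw [mul_sub, Finset.sum_sub_distrib, mul_one, ← this]
    linarith
  have := (Finset.sum_eq_zero_iff_of_nonneg fun j _ =>
    mul_nonneg (hl j) (sub_nonneg.2 (hle j))).1 hsum i (Finset.mem_univ i)
  have := (mul_eq_zero.1 this).resolve_left hi
  linarith

/-- A subgradient pairs to 1 with every weighted `p i`, hence to `∑ a i = 0` with the combination.
-/
theorem sum_smul_mem_tangentSpace (hφ : IsFinslerNorm φ) {p : ι → E d}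
    (hp : ∀ i x, ⟪p i, x⟫ ≤ φ x) {y : E d} (hy : y ≠ 0) {l : ι → ℝ} (hl : ∀ i, 0 ≤ l i)
    (hface : ∀ i, l i ≠ 0 → ⟪p i, y⟫ = φ y) {a : ι → ℝ} (ha : ∀ i, l i = 0 → a i = 0)
    (hsum : ∑ i, a i = 0) :
    ∑ i, a i • p i ∈ tangentSpace (∑ i, l i • p i) φ := by
  rw [tangentSpace, Submodule.mem_orthogonal]
  intro v hv
  induction hv using Submodule.span_induction with
  | mem v hv =>
    rw [inner_sum, ← hsum]
    refine Finset.sum_congr rfl fun i _ => ?_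
    rw [real_inner_smul_right]
    by_cases h : l i = 0
    · simp [ha i h]
    · rw [inner_eq_one_of_mem_subdiff hφ hp hy hl hface hv h, mul_one]
  | zero => simp
  | add x y _ _ hx hy => rw [inner_add_left, hx, hy, add_zero]
  | smul c x _ hx => rw [real_inner_smul_left, hx, mul_zero]

/-- The points of a polyhedral norm which are almost active at `q` lie in a common face. -/
theorem exists_common_face (hφ : IsFinslerNorm φ) (hc : Continuous φ) (p : ι → E d)
    (hp : ∀ i x, ⟪p i, x⟫ ≤ φ x) :
    ∃ η : ℝ, 0 < η ∧ ∀ q, q ≠ 0 →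
      ∃ y, y ≠ 0 ∧ ∀ i, (1 - η) * φ q ≤ ⟪p i, q⟫ → ⟪p i, y⟫ = φ y := by
  have key : ∃ η : ℝ, 0 < η ∧ ∀ q ∈ Metric.sphere (0 : E d) 1,
      ∃ y, y ≠ 0 ∧ ∀ i, (1 - η) * φ q ≤ ⟪p i, q⟫ → ⟪p i, y⟫ = φ y := by
    -- Having a uniform `η` passes to subsets and finite unions, so it suffices to find one near
    -- each point of the sphere.
    refine (isCompact_sphere (0 : E d) 1).induction_on
      (p := fun s => ∃ η : ℝ, 0 < η ∧ ∀ q ∈ s,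
        ∃ y, y ≠ 0 ∧ ∀ i, (1 - η) * φ q ≤ ⟪p i, q⟫ → ⟪p i, y⟫ = φ y) ?_ ?_ ?_ ?_
    · exact ⟨1, one_pos, by simp⟩
    · rintro s t hst ⟨η, h0, h⟩
      exact ⟨η, h0, fun q hq => h q (hst hq)⟩
    · rintro s t ⟨η₁, h1, hs⟩ ⟨η₂, h2, ht⟩
      have aux : ∀ η q, min η₁ η₂ ≤ η → (1 - η) * φ q ≤ (1 - min η₁ η₂) * φ q := fun η q h =>
        mul_le_mul_of_nonneg_right (by linarith) (hφ.nonneg q)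
      refine ⟨min η₁ η₂, lt_min h1 h2, ?_⟩
      rintro q (hq | hq)
      · obtain ⟨y, hy, h⟩ := hs q hq
        exact ⟨y, hy, fun i hi => h i ((aux _ q (min_le_left _ _)).trans hi)⟩
      · obtain ⟨y, hy, h⟩ := ht q hq
        exact ⟨y, hy, fun i hi => h i ((aux _ q (min_le_right _ _)).trans hi)⟩
    · intro y hy
      have hy0 : y ≠ 0 := fun h => by simp [h] at hy
      -- Indices inactive at `y` are not even almost active at nearby points, for small `η`; so `y`
      -- itself is the witness for its neighbourhood.
      have hev : ∀ᶠ z : ℝ × E d in 𝓝 0 ×ˢ 𝓝 y,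
          ∀ i, ⟪p i, y⟫ < φ y → ⟪p i, z.2⟫ < (1 - z.1) * φ z.2 := by
        rw [← nhds_prod_eq]
        refine eventually_all.2 fun i => ?_
        by_cases h : ⟪p i, y⟫ < φ y
        · have c1 : Continuous fun z : ℝ × E d => ⟪p i, z.2⟫ := by fun_prop
          have c2 : Continuous fun z : ℝ × E d => (1 - z.1) * φ z.2 := by fun_prop
          refine (c1.continuousAt.eventually_lt c2.continuousAt ?_).mono fun z hz _ => hz
          simpa using h
        · exact Eventually.of_forall fun z hz => absurd hz h
      obtain ⟨P, hP, Q, hQ, hPQ⟩ := eventually_prod_iff.1 hev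
      obtain ⟨η, hη, hη0⟩ := ((hP.filter_mono nhdsWithin_le_nhds).and
        (self_mem_nhdsWithin (s := Ioi (0 : ℝ)))).exists
      refine ⟨{q | Q q}, mem_nhdsWithin_of_mem_nhds hQ, η, hη0, fun q hq => ⟨y, hy0, fun i hi => ?_⟩⟩
      by_contra hne
      exact (hPQ hη hq i (lt_of_le_of_ne (hp i y) hne)).not_ge hi
  obtain ⟨η, hη, h⟩ := key
  refine ⟨η, hη, fun q hq => ?_⟩
  have hq' : 0 < ‖q‖ := norm_pos_iff.2 hq
  obtain ⟨y, hy, hy'⟩ := h (‖q‖⁻¹ • q) (by simp [norm_smul, hq'.ne'])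
  refine ⟨y, hy, fun i hi => hy' i ?_⟩
  rw [hφ.pos_homogeneous _ _ (inv_pos.2 hq'), real_inner_smul_right, mul_left_comm]
  exact mul_le_mul_of_nonneg_left hi (inv_pos.2 hq').le

variable [DecidableEq ι]

theorem hessian_comp_pairing_mem_compatSym (hφ : IsFinslerNorm φ) {p : ι → E d}
    (hp : ∀ i x, ⟪p i, x⟫ ≤ φ x) {F : (ι → ℝ) → ℝ} (hF : Monotone F) {q y : E d} (hy : y ≠ 0)
    (hF2 : ContDiffAt ℝ 2 F (pairing p q))
    (hface : ∀ i, partialDeriv F i (pairing p q) ≠ 0 → ⟪p i, y⟫ = φ y)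
    (hsum : ∑ i, partialDeriv F i (pairing p q) ≠ 0) :
    hessian (fun x => F (pairing p x)) q ∈
      compatSym (gradient (fun x => F (pairing p x)) q) φ := by
  refine mem_symOn_of_range_le
    (hessian_symm (hF2.comp q (pairing p).contDiff.contDiffAt)) fun w => ?_
  rw [hessian_comp_pairing p hF2, gradient_comp_pairing p (hF2.differentiableAt (by norm_num))]
  set l := fun i => partialDeriv F i (pairing p q)
  set a := fun i => fderiv ℝ (partialDeriv F i) (pairing p q) (pairing p w)
  -- This `k` makes the coefficients `a i - k * l i` sum to zero: the image of `w` splits into `k`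
  -- times the gradient plus a tangent vector.
  set k := (∑ i, a i) / ∑ i, l i
  have ha : ∀ i, l i = 0 → a i = 0 := fun i h => by
    simp only [a, fderiv_partialDeriv_eq_zero hF h, zero_apply]
  have hT := sum_smul_mem_tangentSpace hφ hp hy (l := l) (a := fun i => a i - k * l i)
    (fun i => partialDeriv_nonneg hF i _) hface (fun i h => by simp [ha i h, h])
    (by rw [Finset.sum_sub_distrib, ← Finset.mul_sum, div_mul_cancel₀ _ hsum, sub_self])
  have : ∑ i, a i • p i = k • ∑ i, l i • p i + ∑ i, (a i - k * l i) • p i := by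
    rw [Finset.smul_sum, ← Finset.sum_add_distrib]
    refine Finset.sum_congr rfl fun i _ => ?_
    module
  change ∑ i, a i • p i ∈ _
  rw [this]
  exact Submodule.add_mem_sup
    (Submodule.smul_mem _ _ (Submodule.mem_span_singleton_self _)) hT

theorem hessian_comp_pairing_mem_symOn (hφ : IsFinslerNorm φ) {p : ι → E d}
    (hp : ∀ i x, ⟪p i, x⟫ ≤ φ x) {F : (ι → ℝ) → ℝ} (hF : Monotone F) {q y : E d} (hy : y ≠ 0)
    (hF2 : ContDiffAt ℝ 2 F (pairing p q))
    (hface : ∀ i, partialDeriv F i (pairing p q) ≠ 0 → ⟪p i, y⟫ = φ y)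
    (hsum : ∀ t, ∑ i, partialDeriv F i t = 1) :
    hessian (fun x => F (pairing p x)) q ∈
      symOn (tangentSpace (gradient (fun x => F (pairing p x)) q) φ) := by
  refine mem_symOn_of_range_le
    (hessian_symm (hF2.comp q (pairing p).contDiff.contDiffAt)) fun w => ?_
  rw [hessian_comp_pairing p hF2, gradient_comp_pairing p (hF2.differentiableAt (by norm_num))]
  refine sum_smul_mem_tangentSpace hφ hp hy (fun i => partialDeriv_nonneg hF i _) hface
    (fun i h => by simp only [fderiv_partialDeriv_eq_zero hF h, zero_apply]) ?_
  -- Differentiating the constant sum of the partial derivatives shows that the Hessian coefficients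
  -- sum to zero, so no gradient component appears.
  have h : HasFDerivAt (fun t => ∑ i, partialDeriv F i t)
      (∑ i, fderiv ℝ (partialDeriv F i) (pairing p q)) (pairing p q) :=
    HasFDerivAt.fun_sum fun i _ => (differentiableAt_partialDeriv hF2 i).hasFDerivAt
  simp_rw [hsum] at h
  have := h.unique (hasFDerivAt_const _ _)
  simpa using congrArg (fun A => A (pairing p w)) this

theorem apply_eq_zero_of_mem_symOn_tangentSpace {g : E d} {X : E d →L[ℝ] E d}
    (hX : X ∈ symOn (tangentSpace g φ)) {v : E d} (hv : v ∈ subdiff (dualNorm φ) g) :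
    X v = 0 := by
  have h : (tangentSpace g φ).starProjection v = 0 := by
    rw [Submodule.starProjection_apply_eq_zero_iff]
    exact Submodule.le_orthogonal_orthogonal _ (Submodule.subset_span hv)
  rw [← hX.2]
  simp [h]

end Faces

/-! ### Averaging against a bump function. -/

section BumpAverage

open MeasureTheory

variable {ι : Type*} [Fintype ι]

theorem exists_contDiffBump_rOut_eq {V : Type*} (x : V) {r : ℝ} (hr : 0 < r) :
    ∃ ρ : ContDiffBump x, ρ.rOut = r :=
  ⟨⟨r / 2, r, half_pos hr, half_lt_self hr⟩, rfl⟩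

/-- The average of `m` against a normalised bump function. -/
noncomputable def bumpAvg (ρ : ContDiffBump (0 : ι → ℝ)) (m : (ι → ℝ) → ℝ) : ℝ :=
  ∫ s, ρ.normed volume s * m s

variable {ρ : ContDiffBump (0 : ι → ℝ)} {m m₁ m₂ : (ι → ℝ) → ℝ}

theorem normed_eq_zero {s : ι → ℝ} (hs : ρ.rOut < ‖s‖) : ρ.normed volume s = 0 := by
  rw [← Function.notMem_support, ρ.support_normed_eq, mem_ball_zero_iff]
  exact hs.not_gt

theorem integrable_normed_mul (hm : Continuous m) :
    Integrable fun s => ρ.normed volume s * m s :=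
  (ρ.continuous_normed.mul hm).integrable_of_hasCompactSupport
    (ρ.hasCompactSupport_normed.mul_right)

theorem bumpAvg_mono (h1 : Continuous m₁) (h2 : Continuous m₂)
    (h : ∀ s, ‖s‖ ≤ ρ.rOut → m₁ s ≤ m₂ s) : bumpAvg ρ m₁ ≤ bumpAvg ρ m₂ := by
  refine integral_mono (integrable_normed_mul h1) (integrable_normed_mul h2) fun s => ?_
  rcases le_or_gt ‖s‖ ρ.rOut with hs | hs
  · exact mul_le_mul_of_nonneg_left (h s hs) (ρ.nonneg_normed s)
  · simp [normed_eq_zero hs]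

theorem bumpAvg_congr (h : ∀ s, ‖s‖ ≤ ρ.rOut → m₁ s = m₂ s) : bumpAvg ρ m₁ = bumpAvg ρ m₂ := by
  refine integral_congr_ae (Eventually.of_forall fun s => ?_)
  rcases le_or_gt ‖s‖ ρ.rOut with hs | hs
  · simp [h s hs]
  · simp [normed_eq_zero hs]

theorem bumpAvg_add (h1 : Continuous m₁) (h2 : Continuous m₂) :
    bumpAvg ρ (fun s => m₁ s + m₂ s) = bumpAvg ρ m₁ + bumpAvg ρ m₂ := by
  simp_rw [bumpAvg, mul_add]
  exact integral_add (integrable_normed_mul h1) (integrable_normed_mul h2)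

theorem bumpAvg_const_mul (c : ℝ) : bumpAvg ρ (fun s => c * m s) = c * bumpAvg ρ m := by
  simp_rw [bumpAvg, mul_left_comm _ c]
  exact integral_const_mul _ _

theorem bumpAvg_const (c : ℝ) : bumpAvg ρ (fun _ => c) = c := by
  rw [bumpAvg, integral_mul_const, ρ.integral_normed, one_mul]

/-- This average is a convolution with a smooth compactly supported kernel, so continuity of `m`
suffices. -/
theorem contDiff_bumpAvg_sub (hm : Continuous m) :
    ContDiff ℝ ∞ fun t => bumpAvg ρ fun s => m (t - s) :=
  ρ.hasCompactSupport_normed.contDiff_convolution_left (ContinuousLinearMap.mul ℝ ℝ)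
    (n := ⊤) (μ := volume) ρ.contDiff_normed hm.locallyIntegrable

theorem abs_apply_le_rOut {s : ι → ℝ} (hs : ‖s‖ ≤ ρ.rOut) (i : ι) :
    -ρ.rOut ≤ s i ∧ s i ≤ ρ.rOut :=
  abs_le.1 ((norm_le_pi_norm s i).trans hs)

/-- Two weights `exp (-s i)`, `exp (-s j)` differ at most by the factor `exp (2 * ρ.rOut)`, so a gap
of that ratio survives the perturbation. -/
theorem exp_mul_le_exp_mul {s : ι → ℝ} (hs : ‖s‖ ≤ ρ.rOut) {i j : ι} {x y : ℝ} (hy : 0 ≤ y)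
    (h : x ≤ Real.exp (-(2 * ρ.rOut)) * y) : Real.exp (-s i) * x ≤ Real.exp (-s j) * y := by
  calc Real.exp (-s i) * x ≤ Real.exp (-s i) * (Real.exp (-(2 * ρ.rOut)) * y) :=
        mul_le_mul_of_nonneg_left h (Real.exp_pos _).le
    _ = Real.exp (-s i + -(2 * ρ.rOut)) * y := by rw [Real.exp_add, mul_assoc]
    _ ≤ _ := mul_le_mul_of_nonneg_right (Real.exp_le_exp.2
        (by linarith [(abs_apply_le_rOut hs i).1, (abs_apply_le_rOut hs j).2])) hy

end BumpAverage

/-! ### The maximum of the coordinates. -/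

section MaxCoord

variable {ι : Type*} [Fintype ι] [Nonempty ι]

/-- The largest coordinate of a vector. -/
noncomputable def maxCoord (t : ι → ℝ) : ℝ := Finset.univ.sup' Finset.univ_nonempty t

theorem le_maxCoord (t : ι → ℝ) (i : ι) : t i ≤ maxCoord t :=
  Finset.le_sup' t (Finset.mem_univ i)

theorem maxCoord_le {t : ι → ℝ} {a : ℝ} (h : ∀ i, t i ≤ a) : maxCoord t ≤ a :=
  Finset.sup'_le _ _ fun i _ => h i

theorem exists_eq_maxCoord (t : ι → ℝ) : ∃ i, t i = maxCoord t := by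
  obtain ⟨i, _, h⟩ := Finset.exists_mem_eq_sup' Finset.univ_nonempty t
  exact ⟨i, h.symm⟩

theorem continuous_maxCoord : Continuous (maxCoord : (ι → ℝ) → ℝ) :=
  Continuous.finset_sup'_apply _ fun i _ => continuous_apply i

theorem maxCoord_mono {t u : ι → ℝ} (h : ∀ i, t i ≤ u i) : maxCoord t ≤ maxCoord u :=
  maxCoord_le fun i => (h i).trans (le_maxCoord u i)

theorem maxCoord_add_le (t u : ι → ℝ) : maxCoord (t + u) ≤ maxCoord t + maxCoord u :=
  maxCoord_le fun i => add_le_add (le_maxCoord t i) (le_maxCoord u i)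

theorem maxCoord_smul {c : ℝ} (hc : 0 ≤ c) (t : ι → ℝ) : maxCoord (c • t) = c * maxCoord t := by
  refine le_antisymm (maxCoord_le fun i => mul_le_mul_of_nonneg_left (le_maxCoord t i) hc) ?_
  obtain ⟨i, hi⟩ := exists_eq_maxCoord t
  rw [← hi]
  exact le_maxCoord (c • t) i

theorem maxCoord_add_const (t : ι → ℝ) (c : ℝ) : maxCoord (fun i => t i + c) = maxCoord t + c := by
  refine le_antisymm (maxCoord_le fun i => by linarith [le_maxCoord t i]) ?_
  obtain ⟨i, hi⟩ := exists_eq_maxCoord t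
  rw [← hi]
  exact le_maxCoord (fun i => t i + c) i

/-- A coordinate dominated by another one does not influence the maximum. -/
theorem maxCoord_congr {t u : ι → ℝ} {i j : ι} (h : ∀ k, k ≠ i → t k = u k) (hij : j ≠ i)
    (ht : t i ≤ t j) (hu : u i ≤ u j) : maxCoord t = maxCoord u := by
  have aux : ∀ t u : ι → ℝ, (∀ k, k ≠ i → t k = u k) → t i ≤ t j → maxCoord t ≤ maxCoord u := by
    intro t u h ht
    refine maxCoord_le fun k => ?_
    by_cases hk : k = i
    · rw [hk]
      exact ht.trans ((h j hij).le.trans (le_maxCoord u j))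
    · exact (h k hk).le.trans (le_maxCoord u k)
  exact le_antisymm (aux t u h ht) (aux u t (fun k hk => (h k hk).symm) hu)

end MaxCoord

/-! ### The additive and multiplicative smoothings of the maximum. -/

section SmoothMax

variable {ι : Type*} [Fintype ι] [Nonempty ι]

/-- The maximum of the coordinates, smoothed by additive averaging. -/
noncomputable def addMax (ρ : ContDiffBump (0 : ι → ℝ)) (t : ι → ℝ) : ℝ :=
  bumpAvg ρ fun s => maxCoord (t - s)

/-- The maximum of the coordinates, smoothed by multiplicative averaging. -/
noncomputable def mulMax (ρ : ContDiffBump (0 : ι → ℝ)) (t : ι → ℝ) : ℝ :=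
  bumpAvg ρ fun s => maxCoord fun i => Real.exp (-s i) * t i

variable (ρ : ContDiffBump (0 : ι → ℝ))

theorem continuous_maxCoord_sub (t : ι → ℝ) : Continuous fun s => maxCoord (t - s) :=
  continuous_maxCoord.comp (by fun_prop)

theorem continuous_maxCoord_exp (t : ι → ℝ) :
    Continuous fun s : ι → ℝ => maxCoord fun i => Real.exp (-s i) * t i :=
  continuous_maxCoord.comp (by fun_prop)

theorem contDiff_addMax : ContDiff ℝ ∞ (addMax ρ) :=
  contDiff_bumpAvg_sub continuous_maxCoord

theorem monotone_addMax : Monotone (addMax ρ) := fun t u h =>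
  bumpAvg_mono (continuous_maxCoord_sub t) (continuous_maxCoord_sub u) fun _ _ =>
    maxCoord_mono fun i => sub_le_sub_right (h i) _

theorem convexOn_addMax : ConvexOn ℝ univ (addMax ρ) := by
  refine ⟨convex_univ, fun t _ u _ a b ha hb hab => ?_⟩
  rw [smul_eq_mul, smul_eq_mul, addMax, addMax, addMax, ← bumpAvg_const_mul, ← bumpAvg_const_mul,
    ← bumpAvg_add ((continuous_maxCoord_sub t).const_mul a)
      ((continuous_maxCoord_sub u).const_mul b)]
  refine bumpAvg_mono (continuous_maxCoord_sub _) (((continuous_maxCoord_sub t).const_mul a).add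
    ((continuous_maxCoord_sub u).const_mul b)) fun s _ => ?_
  have : a • t + b • u - s = a • (t - s) + b • (u - s) := by
    rw [smul_sub, smul_sub, sub_add_sub_comm, ← add_smul, hab, one_smul]
  rw [this, ← maxCoord_smul ha, ← maxCoord_smul hb]
  exact maxCoord_add_le _ _

theorem addMax_add_const (t : ι → ℝ) (c : ℝ) : addMax ρ (fun i => t i + c) = addMax ρ t + c := by
  conv_rhs => rw [← bumpAvg_const (ρ := ρ) c]
  rw [addMax, addMax, ← bumpAvg_add (continuous_maxCoord_sub t) continuous_const]
  congr 1
  ext s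
  rw [← maxCoord_add_const]
  congr 1
  ext i
  simp only [Pi.sub_apply]
  ring

theorem abs_addMax_sub_le (t : ι → ℝ) : |addMax ρ t - maxCoord t| ≤ ρ.rOut := by
  rw [abs_sub_le_iff, sub_le_iff_le_add, sub_le_comm]
  constructor
  · rw [← bumpAvg_const (ρ := ρ) (ρ.rOut + maxCoord t)]
    refine bumpAvg_mono (continuous_maxCoord_sub t) continuous_const fun s hs =>
      maxCoord_le fun i => ?_
    rw [Pi.sub_apply]
    linarith [le_maxCoord t i, (abs_apply_le_rOut hs i).1]
  · rw [← bumpAvg_const (ρ := ρ) (maxCoord t - ρ.rOut)]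
    refine bumpAvg_mono continuous_const (continuous_maxCoord_sub t) fun s hs => ?_
    obtain ⟨i, hi⟩ := exists_eq_maxCoord t
    refine le_trans ?_ (le_maxCoord _ i)
    rw [Pi.sub_apply]
    linarith [(abs_apply_le_rOut hs i).2]

theorem monotone_mulMax : Monotone (mulMax ρ) := fun t u h =>
  bumpAvg_mono (continuous_maxCoord_exp t) (continuous_maxCoord_exp u) fun _ _ =>
    maxCoord_mono fun i => mul_le_mul_of_nonneg_left (h i) (Real.exp_pos _).le

theorem mulMax_smul {c : ℝ} (hc : 0 ≤ c) (t : ι → ℝ) : mulMax ρ (c • t) = c * mulMax ρ t := by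
  rw [mulMax, mulMax, ← bumpAvg_const_mul]
  congr 1
  ext s
  rw [← maxCoord_smul hc]
  congr 1
  ext i
  simp only [Pi.smul_apply, smul_eq_mul]
  ring

theorem mulMax_add_le (t u : ι → ℝ) : mulMax ρ (t + u) ≤ mulMax ρ t + mulMax ρ u := by
  rw [mulMax, mulMax, mulMax,
    ← bumpAvg_add (continuous_maxCoord_exp t) (continuous_maxCoord_exp u)]
  refine bumpAvg_mono (continuous_maxCoord_exp _)
    ((continuous_maxCoord_exp t).add (continuous_maxCoord_exp u)) fun s _ => ?_
  refine le_trans (le_of_eq ?_) (maxCoord_add_le _ _)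
  congr 1
  ext i
  simp [mul_add]

theorem mulMax_le {t : ι → ℝ} (ht : 0 ≤ maxCoord t) :
    mulMax ρ t ≤ Real.exp ρ.rOut * maxCoord t := by
  rw [← bumpAvg_const (ρ := ρ) (Real.exp ρ.rOut * maxCoord t)]
  refine bumpAvg_mono (continuous_maxCoord_exp t) continuous_const fun s hs =>
    maxCoord_le fun i => ?_
  have h1 : Real.exp (-s i) ≤ Real.exp ρ.rOut :=
    Real.exp_le_exp.2 (by linarith [(abs_apply_le_rOut hs i).1])
  calc Real.exp (-s i) * t i ≤ Real.exp (-s i) * maxCoord t :=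
        mul_le_mul_of_nonneg_left (le_maxCoord t i) (Real.exp_pos _).le
    _ ≤ _ := mul_le_mul_of_nonneg_right h1 ht

theorem le_mulMax {t : ι → ℝ} (ht : 0 ≤ maxCoord t) :
    Real.exp (-ρ.rOut) * maxCoord t ≤ mulMax ρ t := by
  rw [← bumpAvg_const (ρ := ρ) (Real.exp (-ρ.rOut) * maxCoord t)]
  refine bumpAvg_mono continuous_const (continuous_maxCoord_exp t) fun s hs => ?_
  obtain ⟨i, hi⟩ := exists_eq_maxCoord t
  refine le_trans ?_ (le_maxCoord _ i)
  rw [hi]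
  exact mul_le_mul_of_nonneg_right
    (Real.exp_le_exp.2 (by linarith [(abs_apply_le_rOut hs i).2])) ht

/-- In logarithmic coordinates `exp (-s i) * t i = exp (log (t i) - s i)`, so the average becomes a
convolution of `exp ∘ maxCoord`. Coordinates that are negative or too small for this never matter to
the maximum and are replaced by a constant `b > 0`. -/
theorem contDiffAt_mulMax {t₀ : ι → ℝ} (ht : 0 < maxCoord t₀) :
    ContDiffAt ℝ ∞ (mulMax ρ) t₀ := by
  classical
  obtain ⟨j, hj⟩ := exists_eq_maxCoord t₀
  -- The halving leaves room to move: if `t j > t₀ j / 2`, then `b ≤ exp (-2 * ρ.rOut) * t j`, so a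
  -- coordinate of size at most `b` stays dominated by the `j`-th under all weights.
  set b := Real.exp (-(2 * ρ.rOut)) * (t₀ j / 2) with hb
  have hj0 : 0 < t₀ j := hj ▸ ht
  have hb0 : 0 < b := by positivity
  have hbj : b < t₀ j := by
    have : Real.exp (-(2 * ρ.rOut)) ≤ 1 := Real.exp_le_one_iff.2 (by linarith [ρ.rOut_pos])
    nlinarith
  -- The case split depends on the fixed `t₀`, not on `t`, which keeps `v` smooth near `t₀`.
  let v : (ι → ℝ) → ι → ℝ := fun t i => Real.log (if b ≤ t₀ i then t i else b)
  have hG : ContDiff ℝ ∞ fun t => bumpAvg ρ fun s => Real.exp (maxCoord (t - s)) :=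
    contDiff_bumpAvg_sub (m := fun t => Real.exp (maxCoord t))
      (Real.continuous_exp.comp continuous_maxCoord)
  have hv : ContDiffAt ℝ ∞ v t₀ := by
    refine contDiffAt_pi.2 fun i => ?_
    by_cases hi : b ≤ t₀ i
    · simp only [v, if_pos hi]
      exact (contDiff_apply ℝ ℝ i).contDiffAt.log (hb0.trans_le hi).ne'
    · simp only [v, if_neg hi]
      exact contDiffAt_const
  refine (hG.contDiffAt.comp t₀ hv).congr_of_eventuallyEq ?_
  have h1 : ∀ᶠ t in 𝓝 t₀, t₀ j / 2 < t j :=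
    (continuous_apply j).continuousAt.eventually_const_lt (by linarith)
  have h2 : ∀ᶠ t in 𝓝 t₀, ∀ i, (b ≤ t₀ i → 0 < t i) ∧ (¬ b ≤ t₀ i → t i < b) := by
    refine eventually_all.2 fun i => ?_
    by_cases hi : b ≤ t₀ i
    · refine ((continuous_apply i).tendsto t₀ |>.eventually_const_lt (hb0.trans_le hi)).mono
        fun t h => ⟨fun _ => h, fun h' => absurd hi h'⟩
    · refine ((continuous_apply i).tendsto t₀ |>.eventually_lt_const (not_le.1 hi)).mono
        fun t h => ⟨fun h' => absurd h' hi, fun _ => h⟩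
  filter_upwards [h1, h2] with t ht1 ht2
  refine bumpAvg_congr fun s hs => ?_
  have hvt : ∀ i, Real.exp ((v t - s) i) =
      Real.exp (-s i) * (if b ≤ t₀ i then t i else b) := by
    intro i
    rw [Pi.sub_apply, sub_eq_neg_add, Real.exp_add, Real.exp_log]
    split_ifs with hi
    · exact (ht2 i).1 hi
    · exact hb0
  have hb' : b ≤ Real.exp (-(2 * ρ.rOut)) * t j := by
    rw [hb]; gcongr
  have htj : 0 ≤ t j := by linarith
  have hvj : Real.exp (-s j) * t j = Real.exp ((v t - s) j) := by rw [hvt, if_pos hbj.le]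
  refine le_antisymm (maxCoord_le fun i => ?_) ?_
  · by_cases hi : b ≤ t₀ i
    · refine le_trans (le_of_eq ?_) (Real.exp_le_exp.2 (le_maxCoord (v t - s) i))
      rw [hvt, if_pos hi]
    · refine le_trans (exp_mul_le_exp_mul (j := j) hs htj (((ht2 i).2 hi).le.trans hb')) ?_
      rw [hvj]
      exact Real.exp_le_exp.2 (le_maxCoord (v t - s) j)
  · obtain ⟨i, hi⟩ := exists_eq_maxCoord (v t - s)
    rw [← hi, hvt]
    split_ifs with hbi
    · exact le_maxCoord (fun i => Real.exp (-s i) * t i) i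
    · exact (exp_mul_le_exp_mul hs htj hb').trans
        (le_maxCoord (fun i => Real.exp (-s i) * t i) j)

variable [DecidableEq ι]

/-- Translations move each coordinate by at most `ρ.rOut`, so one lying more than `2 * ρ.rOut` below
the top never influences the averaged maximum. -/
theorem partialDeriv_addMax_eq_zero {t : ι → ℝ} {i : ι} (hi : t i < maxCoord t - 2 * ρ.rOut) :
    partialDeriv (addMax ρ) i t = 0 := by
  obtain ⟨j, hj⟩ := exists_eq_maxCoord t
  have hr := ρ.rOut_pos
  have hij : j ≠ i := by rintro rfl; linarith
  refine partialDeriv_eq_zero_of_eventually ((contDiff_addMax ρ).differentiable (by simp) t) ?_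
  have : ∀ᶠ a : ℝ in 𝓝 0, t i + a < t j - 2 * ρ.rOut :=
    Continuous.continuousAt (by fun_prop) |>.eventually_lt_const (by simpa [hj] using hi)
  filter_upwards [this] with a ha
  refine bumpAvg_congr fun s hs => ?_
  have h1 := abs_apply_le_rOut hs i
  have h2 := abs_apply_le_rOut hs j
  refine maxCoord_congr (i := i) (j := j) (fun k hk => ?_) hij ?_ ?_
  · simp [hk]
  · simp only [Pi.sub_apply, Pi.add_apply, Pi.smul_apply, Pi.single_eq_same, smul_eq_mul, mul_one,
      Pi.single_eq_of_ne hij, mul_zero, add_zero]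
    linarith
  · simp only [Pi.sub_apply]
    linarith

theorem partialDeriv_mulMax_eq_zero {t : ι → ℝ} (ht : 0 < maxCoord t) {i : ι}
    (hi : t i < Real.exp (-(2 * ρ.rOut)) * maxCoord t) :
    partialDeriv (mulMax ρ) i t = 0 := by
  obtain ⟨j, hj⟩ := exists_eq_maxCoord t
  have hr := ρ.rOut_pos
  have hij : j ≠ i := by
    rintro rfl
    have : Real.exp (-(2 * ρ.rOut)) ≤ 1 := Real.exp_le_one_iff.2 (by linarith)
    nlinarith
  refine partialDeriv_eq_zero_of_eventually
    ((contDiffAt_mulMax ρ ht).differentiableAt (by simp)) ?_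
  have : ∀ᶠ a : ℝ in 𝓝 0, t i + a < Real.exp (-(2 * ρ.rOut)) * t j :=
    Continuous.continuousAt (by fun_prop) |>.eventually_lt_const (by simpa [hj] using hi)
  filter_upwards [this] with a ha
  refine bumpAvg_congr fun s hs => ?_
  have hj0 : 0 ≤ t j := (hj ▸ ht).le
  refine maxCoord_congr (i := i) (j := j) (fun k hk => ?_) hij ?_ ?_
  · simp [hk]
  · simp only [Pi.add_apply, Pi.smul_apply, Pi.single_eq_same, smul_eq_mul, mul_one,
      Pi.single_eq_of_ne hij, mul_zero, add_zero]
    exact exp_mul_le_exp_mul hs hj0 ha.le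
  · exact exp_mul_le_exp_mul hs hj0 (hj ▸ hi.le)

theorem sum_partialDeriv_addMax (t : ι → ℝ) : ∑ i, partialDeriv (addMax ρ) i t = 1 := by
  -- The sum of the partial derivatives is the derivative along the diagonal `(1, …, 1)`, where
  -- `addMax` has slope 1.
  have h := ((contDiff_addMax ρ).differentiable (by simp) t).hasFDerivAt.hasLineDerivAt 1
  have h' : HasDerivAt (fun a : ℝ => addMax ρ (t + a • (1 : ι → ℝ)))
    (fderiv ℝ (addMax ρ) t 1) 0 := h
  have e : (fun a : ℝ => addMax ρ (t + a • (1 : ι → ℝ))) = fun a => addMax ρ t + a := by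
    ext a
    rw [← addMax_add_const]
    congr 1
    ext i
    simp
  rw [e] at h'
  have := h'.unique ((hasDerivAt_id (0 : ℝ)).const_add (addMax ρ t))
  simpa [fderiv_eq_sum_partialDeriv] using this

/-- Otherwise all partial derivatives, being nonnegative, vanish, and Euler's identity for
homogeneous functions gives `mulMax ρ t = 0`, against `le_mulMax`. -/
theorem sum_partialDeriv_mulMax_ne_zero {t : ι → ℝ} (ht : 0 < maxCoord t) :
    ∑ i, partialDeriv (mulMax ρ) i t ≠ 0 := by
  intro h0
  have hz := (Finset.sum_eq_zero_iff_of_nonneg fun i _ =>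
    partialDeriv_nonneg (monotone_mulMax ρ) i t).1 h0
  have h : HasDerivAt (fun a : ℝ => mulMax ρ (t + a • t)) (fderiv ℝ (mulMax ρ) t t) 0 :=
    ((contDiffAt_mulMax ρ ht).differentiableAt (by simp)).hasFDerivAt.hasLineDerivAt t
  have e : (fun a : ℝ => mulMax ρ (t + a • t)) =ᶠ[𝓝 0] fun a => (1 + a) * mulMax ρ t := by
    filter_upwards [lt_mem_nhds (show (-1 : ℝ) < 0 by norm_num)] with a ha
    rw [← mulMax_smul ρ (by linarith : (0 : ℝ) ≤ 1 + a), add_smul, one_smul]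
  have h2 := (h.congr_of_eventuallyEq e.symm).unique
    (((hasDerivAt_id (0 : ℝ)).const_add 1).mul_const (mulMax ρ t))
  rw [fderiv_eq_sum_partialDeriv, Finset.sum_eq_zero fun i hi => by rw [hz i hi, mul_zero],
    one_mul] at h2
  have := le_mulMax ρ ht.le
  have := mul_pos (Real.exp_pos (-ρ.rOut)) ht
  linarith

end SmoothMax

/-! ### Approximation of a polyhedral norm. -/

section Polyhedral

variable {d : ℕ} {φ : E d → ℝ}

theorem IsPolyhedralFinslerNorm.exists_eq_maxCoord (hφ : IsPolyhedralFinslerNorm φ) :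
    ∃ P : Finset (E d), ∃ _ : Nonempty P,
      ∀ q, φ q = maxCoord (pairing (fun i : P => (i : E d)) q) := by
  obtain ⟨P, -, hP⟩ := hφ.exists_points
  have hne : Nonempty P := by
    obtain ⟨p, hp, -⟩ := (hP 0).1
    exact ⟨⟨p, hp⟩⟩
  refine ⟨P, hne, fun q => le_antisymm ?_ (maxCoord_le fun i => (hP q).2 ⟨i, i.2, rfl⟩)⟩
  obtain ⟨p, hp, h⟩ := (hP q).1
  rw [h]
  exact le_maxCoord (pairing (fun i : P => (i : E d)) q) ⟨p, hp⟩

theorem IsFinslerNorm.map_zero (hφ : IsFinslerNorm φ) : φ 0 = 0 := by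
  have := hφ.pos_homogeneous 2 0 two_pos
  rw [smul_zero] at this
  linarith

variable {ι : Type*} [Fintype ι] [Nonempty ι] {p : ι → E d}

theorem isShieldingNorm_mulMax_comp_pairing (hφ : IsFinslerNorm φ)
    (hmax : ∀ q, φ q = maxCoord (pairing p q)) {η : ℝ}
    (hη : ∀ q, q ≠ 0 → ∃ y, y ≠ 0 ∧ ∀ i, (1 - η) * φ q ≤ ⟪p i, q⟫ → ⟪p i, y⟫ = φ y)
    (ρ : ContDiffBump (0 : ι → ℝ)) (hρ : 2 * ρ.rOut ≤ η) :
    IsShieldingNorm φ fun q => mulMax ρ (pairing p q) := by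
  classical
  have hpos : ∀ {q}, q ≠ 0 → 0 < maxCoord (pairing p q) := fun {q} hq => by
    rw [← hmax]; exact hφ.pos hq
  have hle : ∀ q, Real.exp (-ρ.rOut) * φ q ≤ mulMax ρ (pairing p q) := fun q => by
    rw [hmax]
    exact le_mulMax ρ (by rw [← hmax]; exact hφ.nonneg q)
  refine ⟨⟨fun q => ?_, fun r q hr => ?_, fun q₁ q₂ => ?_, ?_⟩, fun q hq => ?_, fun q hq => ?_⟩
  · exact (mul_nonneg (Real.exp_pos _).le (hφ.nonneg q)).trans (hle q)
  · rw [map_smul, mulMax_smul ρ hr.le]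
  · rw [map_add]
    exact mulMax_add_le ρ _ _
  · obtain ⟨m, hm, h⟩ := hφ.pos_definite
    refine ⟨Real.exp (-ρ.rOut) * m, by positivity, fun q hq => ?_⟩
    calc Real.exp (-ρ.rOut) * m ≤ Real.exp (-ρ.rOut) * (φ q / ‖q‖) := by gcongr; exact h q hq
      _ = Real.exp (-ρ.rOut) * φ q / ‖q‖ := by ring
      _ ≤ _ := by gcongr; exact hle q
  · exact (((contDiffAt_mulMax ρ (hpos hq)).of_le (by norm_cast)).comp q
      (pairing p).contDiff.contDiffAt).contDiffWithinAt
  · obtain ⟨y, hy, hface⟩ := hη q hq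
    refine hessian_comp_pairing_mem_compatSym hφ
      (fun i x => by rw [hmax]; exact le_maxCoord (pairing p x) i) (monotone_mulMax ρ) hy
      ((contDiffAt_mulMax ρ (hpos hq)).of_le (by norm_cast)) (fun i hi => hface i ?_)
      (sum_partialDeriv_mulMax_ne_zero ρ (hpos hq))
    have h1 : Real.exp (-(2 * ρ.rOut)) * maxCoord (pairing p q) ≤ ⟪p i, q⟫ :=
      not_lt.1 fun h => hi (partialDeriv_mulMax_eq_zero ρ (hpos hq) h)
    rw [← hmax] at h1
    refine le_trans (mul_le_mul_of_nonneg_right ?_ (hφ.nonneg q)) h1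
    -- `1 - η ≤ 1 - 2 * ρ.rOut ≤ exp (-2 * ρ.rOut)`: indices with nonzero weight are almost active.
    linarith [Real.add_one_le_exp (-(2 * ρ.rOut))]

theorem abs_mulMax_sub_le (ρ : ContDiffBump (0 : ι → ℝ)) {t : ι → ℝ} (ht : 0 ≤ maxCoord t) :
    |mulMax ρ t - maxCoord t| ≤ (Real.exp ρ.rOut - 1) * maxCoord t := by
  have h1 := Real.add_one_le_exp ρ.rOut
  have h2 := Real.add_one_le_exp (-ρ.rOut)
  rw [abs_sub_le_iff]
  constructor
  · linarith [mulMax_le ρ ht]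
  -- The lower error is covered by the same constant, as `1 - exp (-r) ≤ r ≤ exp r - 1`.
  · nlinarith [le_mulMax ρ ht]

theorem addMax_comp_pairing_spec [DecidableEq ι] (hφ : IsFinslerNorm φ)
    (hmax : ∀ q, φ q = maxCoord (pairing p q)) {η c : ℝ} (hη0 : 0 < η)
    (hη : ∀ q, q ≠ 0 → ∃ y, y ≠ 0 ∧ ∀ i, (1 - η) * φ q ≤ ⟪p i, q⟫ → ⟪p i, y⟫ = φ y)
    (ρ : ContDiffBump (0 : ι → ℝ)) (hρ : 2 * ρ.rOut ≤ η * c) {q : E d} (hq0 : q ≠ 0)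
    (hq : c ≤ φ q) :
    dualNorm φ (gradient (fun x => addMax ρ (pairing p x)) q) = 1 ∧
      hessian (fun x => addMax ρ (pairing p x)) q ∈
        symOn (tangentSpace (gradient (fun x => addMax ρ (pairing p x)) q) φ) := by
  have hF2 : ContDiffAt ℝ 2 (addMax ρ) (pairing p q) :=
    (contDiff_addMax ρ).contDiffAt.of_le (by norm_cast)
  have hp : ∀ i x, ⟪p i, x⟫ ≤ φ x := fun i x => by
    rw [hmax]; exact le_maxCoord (pairing p x) i
  obtain ⟨y, hy, hface⟩ := hη q hq0
  have hface' : ∀ i, partialDeriv (addMax ρ) i (pairing p q) ≠ 0 → ⟪p i, y⟫ = φ y := by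
    refine fun i hi => hface i ?_
    have h1 : maxCoord (pairing p q) - 2 * ρ.rOut ≤ ⟪p i, q⟫ :=
      not_lt.1 fun h => hi (partialDeriv_addMax_eq_zero ρ h)
    rw [← hmax] at h1
    -- Since `c ≤ φ q`, the additive slack satisfies `2 * ρ.rOut ≤ η * c ≤ η * φ q`; this is where
    -- staying away from the origin is needed.
    nlinarith
  refine ⟨?_, hessian_comp_pairing_mem_symOn hφ hp (monotone_addMax ρ) hy hF2 hface'
    (sum_partialDeriv_addMax ρ)⟩
  rw [gradient_comp_pairing p (hF2.differentiableAt (by norm_num)),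
    dualNorm_sum_face hφ hp hy (fun i => partialDeriv_nonneg (monotone_addMax ρ) i _) hface',
    sum_partialDeriv_addMax]

theorem IsPolyhedralFinslerNorm.exists_isShieldingNorm (hφ : IsPolyhedralFinslerNorm φ)
    {δ : ℝ} (hδ : 0 < δ) :
    ∃ ψ : E d → ℝ, IsShieldingNorm φ ψ ∧ ∀ e ∈ Metric.sphere (0 : E d) 1, |ψ e - φ e| ≤ δ := by
  obtain ⟨P, _, hmax⟩ := hφ.exists_eq_maxCoord
  set p := fun i : P => (i : E d)
  have hF := hφ.toIsFinslerNorm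
  have hc : Continuous φ := by
    rw [funext hmax]; exact continuous_maxCoord.comp (pairing p).continuous
  obtain ⟨η, hη0, hη⟩ := exists_common_face hF hc p fun i x => by
    rw [hmax]; exact le_maxCoord (pairing p x) i
  obtain ⟨B, hB⟩ := (isCompact_sphere (0 : E d) 1).exists_bound_of_continuousOn hc.continuousOn
  have hev : ∀ᶠ r : ℝ in 𝓝 0, (Real.exp r - 1) * B < δ ∧ 2 * r < η :=
    (Continuous.tendsto' (by fun_prop) _ 0 (by simp) |>.eventually_lt_const hδ).and
      (Continuous.tendsto' (by fun_prop) _ 0 (by simp) |>.eventually_lt_const hη0)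
  obtain ⟨r, ⟨hr1, hr2⟩, hr0⟩ := ((hev.filter_mono nhdsWithin_le_nhds).and
    (self_mem_nhdsWithin (s := Ioi (0 : ℝ)))).exists
  obtain ⟨ρ, rfl⟩ := exists_contDiffBump_rOut_eq (0 : P → ℝ) hr0
  refine ⟨_, isShieldingNorm_mulMax_comp_pairing hF hmax hη ρ hr2.le, fun e he => ?_⟩
  have h := abs_mulMax_sub_le ρ (t := pairing p e) (by rw [← hmax]; exact hF.nonneg e)
  rw [← hmax] at h
  refine h.trans (le_trans ?_ hr1.le)
  exact mul_le_mul_of_nonneg_left ((le_abs_self _).trans (hB e he))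
    (by linarith [Real.add_one_le_exp ρ.rOut, ρ.rOut_pos])

theorem IsPolyhedralFinslerNorm.exists_smooth_approximation (hφ : IsPolyhedralFinslerNorm φ)
    {c : ℝ} (hc : 0 < c) :
    ∃ f : ℕ → E d → ℝ, (∀ n, ContDiff ℝ ∞ (f n) ∧ ConvexOn ℝ univ (f n)) ∧
      TendstoUniformlyOn f φ atTop {q | c ≤ φ q} ∧
      ∀ n q, c ≤ φ q →
        dualNorm φ (gradient (f n) q) = 1 ∧
        hessian (f n) q ∈ symOn (tangentSpace (gradient (f n) q) φ) ∧
        ∀ v ∈ subdiff (dualNorm φ) (gradient (f n) q), hessian (f n) q v = 0 := by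
  classical
  obtain ⟨P, _, hmax⟩ := hφ.exists_eq_maxCoord
  set p := fun i : P => (i : E d)
  have hF := hφ.toIsFinslerNorm
  have hcont : Continuous φ := by
    rw [funext hmax]; exact continuous_maxCoord.comp (pairing p).continuous
  obtain ⟨η, hη0, hη⟩ := exists_common_face hF hcont p fun i x => by
    rw [hmax]; exact le_maxCoord (pairing p x) i
  -- Radii at most `η * c / 2` keep the weighted indices on a common face; the factor `1 / (n + 1)`
  -- gives uniform convergence.
  have hr : ∀ n : ℕ, 0 < η * c / 2 * (1 / ((n : ℝ) + 1)) := fun n => by positivity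
  choose ρ hρ using fun n => exists_contDiffBump_rOut_eq (0 : P → ℝ) (hr n)
  refine ⟨fun n q => addMax (ρ n) (pairing p q), fun n => ⟨?_, ?_⟩, ?_, fun n q hq => ?_⟩
  · exact (contDiff_addMax _).comp (pairing p).contDiff
  · exact (convexOn_addMax (ρ n)).comp_linearMap (pairing p).toLinearMap
  · rw [Metric.tendstoUniformlyOn_iff]
    intro ε hε
    have ht : Tendsto (fun n : ℕ => η * c / 2 * (1 / ((n : ℝ) + 1))) atTop (𝓝 0) := by
      simpa using tendsto_one_div_add_atTop_nhds_zero_nat.const_mul (η * c / 2)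
    filter_upwards [ht.eventually_lt_const hε] with n hn q _
    rw [dist_comm, Real.dist_eq, hmax]
    exact ((abs_addMax_sub_le (ρ n) _).trans_eq (hρ n)).trans_lt hn
  · have hq0 : q ≠ 0 := by
      rintro rfl
      rw [hF.map_zero] at hq
      linarith
    have hle : 2 * (ρ n).rOut ≤ η * c := by
      have h1 : 1 / ((n : ℝ) + 1) ≤ 1 := by
        rw [div_le_one (by positivity)]
        linarith [n.cast_nonneg (α := ℝ)]
      have h2 : 0 < η * c := by positivity
      rw [hρ]
      nlinarith
    obtain ⟨h1, h2⟩ := addMax_comp_pairing_spec hF hmax hη0 hη (ρ n) hle hq0 hq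
    exact ⟨h1, h2, fun v hv => apply_eq_zero_of_mem_symOn_tangentSpace h2 hv⟩

theorem abs_sub_le_mul_norm {ψ : E d → ℝ} (hφ : IsFinslerNorm φ) (hψ : IsFinslerNorm ψ) {δ : ℝ}
    (h : ∀ e ∈ Metric.sphere (0 : E d) 1, |ψ e - φ e| ≤ δ) (q : E d) :
    |ψ q - φ q| ≤ δ * ‖q‖ := by
  by_cases hq : q = 0
  · simp [hq, hφ.map_zero, hψ.map_zero]
  have hq' : 0 < ‖q‖ := norm_pos_iff.2 hq
  have := h (‖q‖⁻¹ • q) (by simp [norm_smul, hq'.ne'])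
  rwa [hφ.pos_homogeneous _ _ (inv_pos.2 hq'), hψ.pos_homogeneous _ _ (inv_pos.2 hq'), ← mul_sub,
    abs_mul, abs_of_pos (inv_pos.2 hq'), inv_mul_le_iff₀ hq', mul_comm] at this

end Polyhedral

theorem theorem1p2 {d : ℕ} (φ : E d → ℝ) (hφ : IsPolyhedralFinslerNorm φ) :
    (∃ ψ : E d → ℝ, IsShieldingNorm φ ψ) ∧
    (∀ δ : ℝ, 0 < δ → ∃ ψ : E d → ℝ, IsShieldingNorm φ ψ ∧
      ∀ e ∈ Metric.sphere (0 : E d) 1, |ψ e - φ e| ≤ δ) ∧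
    (∀ c : ℝ, 0 < c → ∃ f : ℕ → E d → ℝ,
      (∀ n, ContDiff ℝ ∞ (f n) ∧ ConvexOn ℝ univ (f n)) ∧
      TendstoUniformlyOn f φ atTop {q | c ≤ φ q} ∧
      ∀ n q, c ≤ φ q →
        dualNorm φ (gradient (f n) q) = 1 ∧
        hessian (f n) q ∈ symOn (tangentSpace (gradient (f n) q) φ) ∧
        ∀ v ∈ subdiff (dualNorm φ) (gradient (f n) q), hessian (f n) q v = 0) ∧
    (∃ ψ : ℕ → E d → ℝ, (∀ n, IsShieldingNorm φ (ψ n)) ∧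
      TendstoLocallyUniformly ψ φ atTop) := by
  refine ⟨?_, fun δ hδ => hφ.exists_isShieldingNorm hδ,
    fun c hc => hφ.exists_smooth_approximation hc, ?_⟩
  · obtain ⟨ψ, hψ, -⟩ := hφ.exists_isShieldingNorm one_pos
    exact ⟨ψ, hψ⟩
  · have hpos : ∀ n : ℕ, 0 < 1 / ((n : ℝ) + 1) := fun n => by positivity
    choose ψ hψ hδ using fun n => hφ.exists_isShieldingNorm (hpos n)
    refine ⟨ψ, hψ, Metric.tendstoLocallyUniformly_iff.2 fun ε hε x => ?_⟩
    refine ⟨Metric.ball x 1, Metric.ball_mem_nhds x one_pos, ?_⟩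
    have ht : Tendsto (fun n : ℕ => 1 / ((n : ℝ) + 1) * (‖x‖ + 1)) atTop (𝓝 0) := by
      simpa using tendsto_one_div_add_atTop_nhds_zero_nat.mul_const (‖x‖ + 1)
    filter_upwards [ht.eventually_lt_const hε] with n hn y hy
    have hy' : ‖y‖ ≤ ‖x‖ + 1 := by
      have h1 := norm_sub_norm_le y x
      have h2 := mem_ball_iff_norm.1 hy
      linarith
    rw [dist_comm, Real.dist_eq]
    exact ((abs_sub_le_mul_norm hφ.toIsFinslerNorm (hψ n).isFinslerNorm (hδ n) y).trans
      (mul_le_mul_of_nonneg_left hy' (hpos n).le)).trans_lt hn
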